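/- Fix a finite set $\mathcal P$ of processes and a finite set $\mathcal V$ of messages. Events are sends $P!Q(m)$ (performed by $P$) and receptions $P?Q(m)$ ($Q$ receives $m$ from $P$, performed by $Q$). For $u\in\Sigma^*$ let $\mathrm{sent}_{P,Q}(u)$ and $\mathrm{rec}_{P,Q}(u)$ be the sequences of messages sent from $P$ to $Q$, respectively received by $Q$ from $P$, in $u$. A word $w\in\Sigma^\infty=\Sigma^*\cup\Sigma^\omega$ is channel-compliant if $\mathrm{rec}_{P,Q}(w')$ is a prefix of $\mathrm{sent}_{P,Q}(w')$ for every finite prefix $w'$ of $w$ and all $P,Q$. In a word $e_1e_2\cdots$, a send $e_i=P!Q(m)$ is matched by $e_j=P?Q(m)$ if $i<j$ and $\mathrm{sent}_{P,Q}(e_1\cdots e_i)=\mathrm{rec}_{P,Q}(e_1\cdots e_j)$. For a channel-compliant word $w$, $\mathrm{msc}(w)$ is its prefix message sequence chart: its event nodes are the positions of $w$, labelled by their events, the nodes of each process are totally ordered by position, and each matched send is linked to its matching reception. A linearisation of $\mathrm{msc}(w)$ is a finite or infinite sequence (of order type at most $\omega$) containing every node exactly once and respecting the reflexive-transitive closure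 of the process orders and the send-receive links. **Global types** are given by $G ::= 0 \mid \sum_{i\in I} P\to Q_i{:}m_i.G_i \mid \mu t.G \mid t$ ($I$ finite), where $Q_i\neq P$ for all $i$, $(Q_i,m_i)\ne(Q_j,m_j)$ for $i\ne j$, at least one message exchange occurs between $\mu t$ and $t$, all recursion variables are bound, and each variable is bound at most once. $\mathcal L(G)\subseteq\Sigma^\infty$ is the set of traces of the runs starting in $G$ that are infinite or end in $0$, in the automaton whose states are the subterms of $G$ and whose transitions are $\sum_i P\to Q_i{:}m_i.G_i \to G_j$ with trace $P!Q_j(m_j)\,P?Q_j(m_j)$, and $\mu t.G'\to G'$ and $t\to\mu t.G'$ with empty trace. **Execution language.** Let $\sim$ be the equivalence relation on $\Sigma^*$ generated by, for $w,u\in\Sigma^*$, (1) $w.P!Q(m).R!S(m').u\sim w.R!S(m').P!Q(m).u$ if $P\neq R$; (2) $w.P?Q(m).R?S(m').u\sim w.R?S(m').P?Q(m).u$ if $Q\neq S$; (3) $w.P!Q(m).R?S(m').u\sim w.R?S(m').P!Q(m).u$ if $P\neq S$ and ($P\neq R$ or $Q\neq S$); (4) $w.P!Q(m).P?Q(m').u\sim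 w.P?Q(m').P!Q(m).u$ if $|\mathrm{sent}_{P,Q}(w)|>|\mathrm{rec}_{P,Q}(w)|$. For $u,v\in\Sigma^*$ write $u\preceq_\sim v$ if $ux\sim v$ for some $x\in\Sigma^*$; for $u,v\in\Sigma^\omega$ write $u\preceq^\omega_\sim v$ if every finite prefix $u'$ of $u$ has a finite prefix $v'$ of $v$ with $u'\preceq_\sim v'$. The closure $\mathcal C^\sim(L)$ consists of the finite words $w'$ with $w'\sim w$ for some finite $w\in L$ and the infinite words $w'$ with $w'\preceq^\omega_\sim w$ for some infinite $w\in L$. **Theorem.** For every global type $G$: 1. $\mathcal C^\sim(\mathcal L(G))$ is half-duplex: for every word $w$ in it, every finite prefix $w'$ of $w$ and all processes $P,Q$, $\mathrm{sent}_{P,Q}(w')=\mathrm{rec}_{P,Q}(w')$ or $\mathrm{sent}_{Q,P}(w')=\mathrm{rec}_{Q,P}(w')$. 2. $\mathcal C^\sim(\mathcal L(G))$ is existentially $1$-bounded, where among its infinite words only those in which every send is matched are considered: every finite word $w\in\mathcal C^\sim(\mathcal L(G))$, and every infinite word $w\in\mathcal C^\sim(\mathcal L(G))$ in which every send is matched,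 is channel-compliant, and $\mathrm{msc}(w)$ has a linearisation in which, for every finite prefix $w'$ of its label sequence and all processes $P,Q$, $|\mathrm{sent}_{P,Q}(w')|-|\mathrm{rec}_{P,Q}(w')|\le 1$. 3. $\mathcal C^\sim(\mathcal L(G))$ is $1$-synchronisable: every word $w$ in it is channel-compliant, and $\mathrm{msc}(w)$ has a linearisation that splits into a finite or infinite sequence of blocks, each consisting of at most one send followed by at most one reception, such that every send and its matching reception lie in the same block. -/

import Mathlib

/-! ### Finite and infinite words -/

/-- A finite or infinite word over `α`, i.e. an element of `α^∞ = α^* ∪ α^ω`. -/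
inductive Word (α : Type*) where
  | fin : List α → Word α
  | inf : (ℕ → α) → Word α

namespace Word

variable {α β : Type*}

/-- The letter at position `i` (counting from `0`), if there is one. -/
def nth : Word α → ℕ → Option α
  | fin l, i => l[i]?
  | inf f, i => some (f i)

/-- The prefix consisting of the first `n` letters (all letters if there are fewer than `n`).
The finite prefixes of `w` are exactly the lists `w.take n`. -/
def take : Word α → ℕ → List α
  | fin l, n => l.take n
  | inf f, n => (List.range n).map f

/-- Letterwise image of a word. -/
def map (g : α → β) : Word α → Word β
  | fin l => fin (l.map g)
  | inf f => inf fun i => g (f i)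

/-- The word is infinite. -/
def IsInfinite : Word α → Prop
  | fin _ => False
  | inf _ => True

/-- `IsConcat b w`: the word `w` is the infinite concatenation `b 0 ⬝ b 1 ⬝ b 2 ⋯`; the pieces may
be empty, so the result may be finite. -/
def IsConcat (b : ℕ → List α) (w : Word α) : Prop :=
  (∀ n, ∃ k, ((List.range n).map b).flatten = w.take k) ∧
  (∀ k, ∃ n, w.take k <+: ((List.range n).map b).flatten)

theorem take_add_one (w : Word α) (n : ℕ) : w.take (n + 1) = w.take n ++ (w.nth n).toList := by
  cases w with
  | fin l => simp [take, nth, List.take_add_one]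
  | inf f => simp [take, nth, List.range_succ]

end Word

/-! ### Events -/

/-- Events over processes `Pr` and messages `Msg`: `send p q m` is `p!q m` (process `p` sends `m` to
`q`), and `recv p q m` is the event of process `q` receiving `m` from `p`. In both cases the first
process is the sender and the second one is the receiver. -/
inductive Event (Pr Msg : Type*) where
  | send : Pr → Pr → Msg → Event Pr Msg
  | recv : Pr → Pr → Msg → Event Pr Msg

namespace Event

variable {Pr Msg : Type*}

/-- The process performing the event. -/
def actor : Event Pr Msg → Pr
  | send p _ _ => p
  | recv _ q _ => q

/-- The event is a send event. -/
def IsSend : Event Pr Msg → Prop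
  | send _ _ _ => True
  | recv _ _ _ => False

/-- The event is a receive event. -/
def IsRecv : Event Pr Msg → Prop
  | send _ _ _ => False
  | recv _ _ _ => True

open Classical in
/-- The message of a send event from `P` to `Q`; `none` for all other events. -/
noncomputable def sendMsg (P Q : Pr) : Event Pr Msg → Option Msg
  | send p q m => if p = P ∧ q = Q then some m else none
  | recv _ _ _ => none

open Classical in
/-- The message of a receive event from `P` to `Q`; `none` for all other events. -/
noncomputable def recvMsg (P Q : Pr) : Event Pr Msg → Option Msg
  | send _ _ _ => none
  | recv p q m => if p = P ∧ q = Q then some m else none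

end Event

/-- The sequence of messages sent from `P` to `Q` in `u`. -/
noncomputable def sent {Pr Msg : Type*} (P Q : Pr) (u : List (Event Pr Msg)) : List Msg :=
  u.filterMap (Event.sendMsg P Q)

/-- The sequence of messages received by `Q` from `P` in `u`. -/
noncomputable def received {Pr Msg : Type*} (P Q : Pr) (u : List (Event Pr Msg)) : List Msg :=
  u.filterMap (Event.recvMsg P Q)

namespace Word

variable {Pr Msg : Type*}

/-- In every prefix and for all processes `P`, `Q`, the messages received by `Q` from `P` form a
prefix of the messages sent from `P` to `Q`. -/
def ChannelCompliant (w : Word (Event Pr Msg)) : Prop :=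
  ∀ n P Q, received P Q (w.take n) <+: sent P Q (w.take n)

/-- The send event at position `i` is matched by the receive event at position `j`. -/
def Matched (w : Word (Event Pr Msg)) (i j : ℕ) : Prop :=
  ∃ P Q m, w.nth i = some (Event.send P Q m) ∧ w.nth j = some (Event.recv P Q m) ∧ i < j ∧
    sent P Q (w.take (i + 1)) = received P Q (w.take (j + 1))

/-- Every send event of the word is matched. -/
def AllMatched (w : Word (Event Pr Msg)) : Prop :=
  ∀ i P Q m, w.nth i = some (Event.send P Q m) → ∃ j, w.Matched i j

/-- Half-duplex: in every prefix, for all `P`, `Q`, one of the two channels between `P` and `Q`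
is empty. -/
def HalfDuplex (w : Word (Event Pr Msg)) : Prop :=
  ∀ n P Q, sent P Q (w.take n) = received P Q (w.take n) ∨
    sent Q P (w.take n) = received Q P (w.take n)

/-- `B`-bounded: in every prefix, every channel carries at most `B` messages. -/
def Bounded (B : ℕ) (w : Word (Event Pr Msg)) : Prop :=
  ∀ n P Q, ((sent P Q (w.take n)).length : ℤ) - (received P Q (w.take n)).length ≤ B

end Word

/-! ### Prefix message sequence charts -/

/-- A prefix message sequence chart that respects FIFO order. The nodes are the event nodes; send
nodes and receive nodes are told apart by their labels. The partial injective function from send to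
receive nodes is given by its graph `link`. -/
structure PrefixMSC (Pr Msg : Type*) where
  Node : Type
  proc : Node → Pr
  link : Node → Node → Prop
  label : Node → Event Pr Msg
  /-- The order of the event nodes of each process. -/
  le : Pr → Node → Node → Prop
  link_functional : ∀ s r r', link s r → link s r' → r = r'
  link_injective : ∀ s s' r, link s r → link s' r → s = s'
  /-- Linked nodes carry corresponding labels. -/
  label_link : ∀ s r, link s r → ∃ m,
    label s = Event.send (proc s) (proc r) m ∧ label r = Event.recv (proc s) (proc r) m
  /-- A node that is not linked is an unmatched send node of its process. -/
  label_unlinked : ∀ e, (∀ e', ¬ link e e' ∧ ¬ link e' e) →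
    ∃ Q m, label e = Event.send (proc e) Q m
  /-- `le P` relates nodes of `P` only, and orders them totally. -/
  le_proc : ∀ P e e', le P e e' → proc e = P ∧ proc e' = P
  le_refl : ∀ P e, proc e = P → le P e e
  le_trans : ∀ P e e' e'', le P e e' → le P e' e'' → le P e e''
  le_antisymm : ∀ P e e', le P e e' → le P e' e → e = e'
  le_total : ∀ P e e', proc e = P → proc e' = P → le P e e' ∨ le P e' e
  /-- FIFO: if the later one of two sends on the same channel is received, then the earlier one is
  received, and not after it. -/
  fifo : ∀ P Q m₁ m₂ e₁ e₂ r₂, label e₁ = Event.send P Q m₁ → label e₂ = Event.send P Q m₂ →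
    le P e₁ e₂ → link e₂ r₂ → ∃ r₁, link e₁ r₁ ∧ le Q r₁ r₂

namespace PrefixMSC

variable {Pr Msg : Type*}

/-- The order on all event nodes: the reflexive and transitive closure of the send-receive relation
and the process orders. -/
def order (M : PrefixMSC Pr Msg) : M.Node → M.Node → Prop :=
  Relation.ReflTransGen fun e e' => M.link e e' ∨ ∃ P, M.le P e e'

/-- A linearisation: a word that contains every event node exactly once and is compatible with the
order on the event nodes. -/
def IsLinearisation (M : PrefixMSC Pr Msg) (u : Word M.Node) : Prop :=
  (∀ e, ∃! i, u.nth i = some e) ∧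
  (∀ i j e e', u.nth i = some e → u.nth j = some e' → M.order e e' → i ≤ j)

/-- There is a `B`-bounded linearisation. -/
def ExistentiallyBounded (B : ℕ) (M : PrefixMSC Pr Msg) : Prop :=
  ∃ u, M.IsLinearisation u ∧ (u.map M.label).Bounded B

/-- A sequence of event nodes is a `k`-exchange (as far as its labels are concerned): at most `k`
sends followed by at most `k` receives. -/
def IsExchange (M : PrefixMSC Pr Msg) (k : ℕ) (b : List M.Node) : Prop :=
  ∃ s r, b = s ++ r ∧ s.length ≤ k ∧ r.length ≤ k ∧
    (∀ e ∈ s, (M.label e).IsSend) ∧ (∀ e ∈ r, (M.label e).IsRecv)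

/-- There is a linearisation that splits into `k`-exchanges such that linked nodes belong to the
same exchange. (Exchanges may be empty, so a finite splitting is covered by padding.) -/
def Synchronous (k : ℕ) (M : PrefixMSC Pr Msg) : Prop :=
  ∃ u, M.IsLinearisation u ∧ ∃ b : ℕ → List M.Node, Word.IsConcat b u ∧
    (∀ i, M.IsExchange k (b i)) ∧ (∀ e e', M.link e e' → ∃ i, e ∈ b i ∧ e' ∈ b i)

end PrefixMSC

/-! ### The prefix message sequence chart of a channel-compliant word -/

namespace Word

variable {α Pr Msg : Type*}

theorem filterMap_take_succ {γ : Type*} (g : α → Option γ) (w : Word α) (n : ℕ) :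
    (w.take (n + 1)).filterMap g = (w.take n).filterMap g ++ ((w.nth n).bind g).toList := by
  rw [take_add_one, List.filterMap_append]
  cases h : w.nth n with
  | none => simp
  | some a => cases h' : g a <;> simp [h']

theorem filterMap_take_mono {γ : Type*} (g : α → Option γ) (w : Word α) {m n : ℕ} (h : m ≤ n) :
    (w.take m).filterMap g <+: (w.take n).filterMap g := by
  induction n, h using Nat.le_induction with
  | base => exact List.prefix_rfl
  | succ n _ ih =>
    rw [filterMap_take_succ]
    exact ih.trans (List.prefix_append _ _)

/-- The position at which the filtered prefix reaches a given prefix of a later filtered prefix. -/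
theorem exists_reach {γ : Type*} (g : α → Option γ) (w : Word α) (N : ℕ) (l : List γ) (c : γ)
    (h : l ++ [c] <+: (w.take N).filterMap g) :
    ∃ i < N, (w.nth i).bind g = some c ∧ (w.take (i + 1)).filterMap g = l ++ [c] := by
  induction N with
  | zero => cases w <;> simp [take] at h
  | succ N ih =>
    by_cases hN : l ++ [c] <+: (w.take N).filterMap g
    · obtain ⟨i, hi, h1, h2⟩ := ih hN
      exact ⟨i, by omega, h1, h2⟩
    · refine ⟨N, by omega, ?_⟩
      have hs := filterMap_take_succ g w N
      cases hb : (w.nth N).bind g with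
      | none =>
        rw [hb] at hs
        simp only [Option.toList_none, List.append_nil] at hs
        exact absurd (hs ▸ h) hN
      | some a =>
        rw [hb] at hs
        simp only [Option.toList_some] at hs
        rw [hs] at h
        rcases List.prefix_concat_iff.1 h with h' | h'
        · have h2 := List.append_inj' h' rfl
          have h3 : c = a := by simpa using h2.2
          exact ⟨by rw [h3], by rw [hs, h']⟩
        · exact absurd h' hN

theorem bind_sendMsg {w : Word (Event Pr Msg)} {i : ℕ} {P Q : Pr} {c : Msg}
    (h : (w.nth i).bind (Event.sendMsg P Q) = some c) : w.nth i = some (Event.send P Q c) := by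
  cases hw : w.nth i with
  | none => simp [hw] at h
  | some e => cases e <;> simp_all [Event.sendMsg]

theorem bind_recvMsg {w : Word (Event Pr Msg)} {i : ℕ} {P Q : Pr} {c : Msg}
    (h : (w.nth i).bind (Event.recvMsg P Q) = some c) : w.nth i = some (Event.recv P Q c) := by
  cases hw : w.nth i with
  | none => simp [hw] at h
  | some e => cases e <;> simp_all [Event.recvMsg]

theorem sent_take_succ {w : Word (Event Pr Msg)} {i : ℕ} {P Q : Pr} {m : Msg}
    (h : w.nth i = some (Event.send P Q m)) :
    sent P Q (w.take (i + 1)) = sent P Q (w.take i) ++ [m] := by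
  simp [sent, filterMap_take_succ, h, Event.sendMsg]

theorem received_take_succ {w : Word (Event Pr Msg)} {i : ℕ} {P Q : Pr} {m : Msg}
    (h : w.nth i = some (Event.recv P Q m)) :
    received P Q (w.take (i + 1)) = received P Q (w.take i) ++ [m] := by
  simp [received, filterMap_take_succ, h, Event.recvMsg]

theorem sent_lt {w : Word (Event Pr Msg)} {i j : ℕ} {P Q : Pr} {m : Msg}
    (h : w.nth j = some (Event.send P Q m)) (hij : i ≤ j) :
    (sent P Q (w.take i)).length < (sent P Q (w.take (j + 1))).length := by
  have h1 := (filterMap_take_mono (Event.sendMsg P Q) w hij).length_le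
  rw [sent_take_succ h]
  simp only [sent, List.length_append, List.length_singleton] at *
  omega

theorem received_lt {w : Word (Event Pr Msg)} {i j : ℕ} {P Q : Pr} {m : Msg}
    (h : w.nth j = some (Event.recv P Q m)) (hij : i ≤ j) :
    (received P Q (w.take i)).length < (received P Q (w.take (j + 1))).length := by
  have h1 := (filterMap_take_mono (Event.recvMsg P Q) w hij).length_le
  rw [received_take_succ h]
  simp only [received, List.length_append, List.length_singleton] at *
  omega

theorem Matched.functional {w : Word (Event Pr Msg)} {i j j' : ℕ} (h : w.Matched i j)
    (h' : w.Matched i j') : j = j' := by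
  obtain ⟨P, Q, m, h1, h2, -, h4⟩ := h
  obtain ⟨P', Q', m', h1', h2', -, h4'⟩ := h'
  rw [h1] at h1'
  cases h1'
  have h5 := congrArg List.length (h4.symm.trans h4')
  by_contra hne
  rcases Nat.lt_or_gt_of_ne hne with hlt | hlt
  · have := received_lt h2' (i := j + 1) (by omega)
    omega
  · have := received_lt h2 (i := j' + 1) (by omega)
    omega

theorem Matched.injective {w : Word (Event Pr Msg)} {i i' j : ℕ} (h : w.Matched i j)
    (h' : w.Matched i' j) : i = i' := by
  obtain ⟨P, Q, m, h1, h2, -, h4⟩ := h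
  obtain ⟨P', Q', m', h1', h2', -, h4'⟩ := h'
  rw [h2] at h2'
  cases h2'
  have h5 := congrArg List.length (h4.trans h4'.symm)
  by_contra hne
  rcases Nat.lt_or_gt_of_ne hne with hlt | hlt
  · have := sent_lt h1' (i := i + 1) (by omega)
    omega
  · have := sent_lt h1 (i := i' + 1) (by omega)
    omega

theorem ChannelCompliant.exists_send {w : Word (Event Pr Msg)} (hw : w.ChannelCompliant) {j : ℕ}
    {P Q : Pr} {m : Msg} (h : w.nth j = some (Event.recv P Q m)) : ∃ i, w.Matched i j := by
  have h1 := hw (j + 1) P Q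
  have h2 := received_take_succ h
  rw [h2] at h1
  obtain ⟨i, hi, hb, hi'⟩ := exists_reach _ _ _ _ _ h1
  have hs := bind_sendMsg hb
  have hne : i ≠ j := by
    rintro rfl
    rw [hs] at h
    cases h
  exact ⟨i, P, Q, m, hs, h, by omega, by rw [h2]; exact hi'⟩

theorem ChannelCompliant.fifo {w : Word (Event Pr Msg)} (hw : w.ChannelCompliant) {i₁ i₂ j₂ : ℕ}
    {P Q : Pr} {m₁ m₂ : Msg} (h₁ : w.nth i₁ = some (Event.send P Q m₁))
    (h₂ : w.nth i₂ = some (Event.send P Q m₂)) (hi : i₁ ≤ i₂) (hm : w.Matched i₂ j₂) :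
    ∃ j₁ ≤ j₂, w.Matched i₁ j₁ := by
  obtain ⟨P', Q', m', h3, h4, h5, h6⟩ := hm
  rw [h₂] at h3
  cases h3
  have h7 : sent P Q (w.take i₁) ++ [m₁] <+: received P Q (w.take (j₂ + 1)) := by
    rw [← h6, ← sent_take_succ h₁]
    exact filterMap_take_mono _ _ (by omega)
  obtain ⟨j, hj, hb, hj'⟩ := exists_reach _ _ _ _ _ h7
  have hr := bind_recvMsg hb
  refine ⟨j, by omega, P, Q, m₁, h₁, hr, ?_, by rw [sent_take_succ h₁]; exact hj'.symm⟩
  by_contra hlt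
  have hne : j ≠ i₁ := by
    rintro rfl
    rw [h₁] at hr
    cases hr
  have h8 := (hw (j + 1) P Q).length_le
  have h9 := (filterMap_take_mono (Event.sendMsg P Q) w (show j + 1 ≤ i₁ by omega)).length_le
  have h10 := congrArg List.length hj'
  simp only [sent, received, List.length_append, List.length_singleton] at *
  omega

/-- The prefix message sequence chart of a channel-compliant word: the event nodes are the positions
of the word, ordered per process by their position, and sends are linked to their matching
receptions. It is the (up to isomorphism unique) prefix message sequence chart of which the word is
a linearisation. -/
def msc (w : Word (Event Pr Msg)) (hw : w.ChannelCompliant) : PrefixMSC Pr Msg where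
  Node := {i : ℕ // (w.nth i).isSome}
  proc i := ((w.nth i).get i.2).actor
  link i j := w.Matched i j
  label i := (w.nth i).get i.2
  le P i j := ((w.nth i).get i.2).actor = P ∧ ((w.nth j).get j.2).actor = P ∧ (i : ℕ) ≤ j
  link_functional _ _ _ h h' := Subtype.ext (h.functional h')
  link_injective _ _ _ h h' := Subtype.ext (h.injective h')
  label_link := by
    rintro s r ⟨P, Q, m, h1, h2, -, -⟩
    refine ⟨m, ?_⟩
    simp [h1, h2, Event.actor]
  label_unlinked := by
    rintro ⟨i, hi⟩ h
    obtain ⟨e, he⟩ := Option.isSome_iff_exists.1 hi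
    cases e with
    | send P Q m => exact ⟨Q, m, by simp [he, Event.actor]⟩
    | recv P Q m =>
      obtain ⟨i', hi'⟩ := hw.exists_send he
      have hs : (w.nth i').isSome := by
        obtain ⟨_, _, _, h1, -⟩ := hi'
        simp [h1]
      exact absurd hi' (h ⟨i', hs⟩).2
  le_proc _ _ _ h := ⟨h.1, h.2.1⟩
  le_refl _ _ h := ⟨h, h, Nat.le_refl _⟩
  le_trans _ _ _ _ h h' := ⟨h.1, h'.2.1, h.2.2.trans h'.2.2⟩
  le_antisymm _ _ _ h h' := Subtype.ext (Nat.le_antisymm h.2.2 h'.2.2)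
  le_total _ i j h h' := (Nat.le_total i j).imp (fun hl => ⟨h, h', hl⟩) (fun hl => ⟨h', h, hl⟩)
  fifo := by
    rintro P Q m₁ m₂ ⟨i₁, hi₁⟩ ⟨i₂, hi₂⟩ ⟨j₂, hj₂⟩ h₁ h₂ hle hm
    have g₁ : w.nth i₁ = some (Event.send P Q m₁) := by simp [← h₁]
    have g₂ : w.nth i₂ = some (Event.send P Q m₂) := by simp [← h₂]
    obtain ⟨j₁, hj, hm₁⟩ := hw.fifo g₁ g₂ hle.2.2 hm
    have k₁ : w.nth j₁ = some (Event.recv P Q m₁) := by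
      obtain ⟨P', Q', m', h1, h2, -, -⟩ := hm₁
      rw [g₁] at h1
      cases h1
      exact h2
    have k₂ : w.nth j₂ = some (Event.recv P Q m₂) := by
      obtain ⟨P', Q', m', h1, h2, -, -⟩ := hm
      rw [g₂] at h1
      cases h1
      exact h2
    exact ⟨⟨j₁, by simp [k₁]⟩, hm₁, by simp [k₁, Event.actor], by simp [k₂, Event.actor], hj⟩

/-- The prefix message sequence chart of the word is defined and has a `B`-bounded linearisation. -/
def ExistentiallyBounded (B : ℕ) (w : Word (Event Pr Msg)) : Prop :=
  ∃ hw : w.ChannelCompliant, (w.msc hw).ExistentiallyBounded B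

/-- The prefix message sequence chart of the word is defined and `k`-synchronous. -/
def Synchronisable (k : ℕ) (w : Word (Event Pr Msg)) : Prop :=
  ∃ hw : w.ChannelCompliant, (w.msc hw).Synchronous k

end Word

/-! ### Channel restrictions of languages -/

/-- Every word of the language is half-duplex. -/
def IsHalfDuplex {Pr Msg : Type*} (L : Set (Word (Event Pr Msg))) : Prop :=
  ∀ w ∈ L, w.HalfDuplex

/-- Every word of the language is existentially `B`-bounded. -/
def IsExistentiallyBounded {Pr Msg : Type*} (B : ℕ) (L : Set (Word (Event Pr Msg))) : Prop :=
  ∀ w ∈ L, w.ExistentiallyBounded B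

/-- Every word of the language is `k`-synchronisable. -/
def IsSynchronisable {Pr Msg : Type*} (k : ℕ) (L : Set (Word (Event Pr Msg))) : Prop :=
  ∀ w ∈ L, w.Synchronisable k

/-! ### The indistinguishability relation -/

/-- One swap of two adjacent independent events. -/
inductive Swap {Pr Msg : Type*} : List (Event Pr Msg) → List (Event Pr Msg) → Prop where
  | send_send (w u) (P Q R S : Pr) (m m' : Msg) (h : P ≠ R) :
      Swap (w ++ Event.send P Q m :: Event.send R S m' :: u)
        (w ++ Event.send R S m' :: Event.send P Q m :: u)
  | recv_recv (w u) (P Q R S : Pr) (m m' : Msg) (h : Q ≠ S) :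
      Swap (w ++ Event.recv P Q m :: Event.recv R S m' :: u)
        (w ++ Event.recv R S m' :: Event.recv P Q m :: u)
  | send_recv (w u) (P Q R S : Pr) (m m' : Msg) (h : P ≠ S ∧ (P ≠ R ∨ Q ≠ S)) :
      Swap (w ++ Event.send P Q m :: Event.recv R S m' :: u)
        (w ++ Event.recv R S m' :: Event.send P Q m :: u)
  | same_channel (w u) (P Q : Pr) (m m' : Msg)
      (h : (sent P Q w).length > (received P Q w).length) :
      Swap (w ++ Event.send P Q m :: Event.recv P Q m' :: u)
        (w ++ Event.recv P Q m' :: Event.send P Q m :: u)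

/-- The indistinguishability relation `∼` on finite words: the equivalence relation generated by
the swaps. -/
def Indist {Pr Msg : Type*} : List (Event Pr Msg) → List (Event Pr Msg) → Prop :=
  Relation.EqvGen Swap

/-- `u ⪯ v`: some extension of `u` is indistinguishable from `v`. -/
def IndistPrefix {Pr Msg : Type*} (u v : List (Event Pr Msg)) : Prop :=
  ∃ x, Indist (u ++ x) v

/-- `f ⪯^ω g` for infinite words: for every finite prefix `u` of `f` there is a finite prefix `v` of
`g` with `u ⪯ v`. -/
def IndistOmega {Pr Msg : Type*} (f g : ℕ → Event Pr Msg) : Prop :=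
  ∀ n, ∃ k, IndistPrefix ((Word.inf f).take n) ((Word.inf g).take k)

/-- The closure of a language under indistinguishability. -/
def indistClosure {Pr Msg : Type*} (L : Set (Word (Event Pr Msg))) : Set (Word (Event Pr Msg)) :=
  {w' | (∃ u v, w' = Word.fin u ∧ Word.fin v ∈ L ∧ Indist u v) ∨
    (∃ f g, w' = Word.inf f ∧ Word.inf g ∈ L ∧ IndistOmega f g)}

/-! ### Global types -/

/-- Raw syntax of global types. In `choice p n q m G`, process `p` chooses `i < n`, sends `m i` to
`q i`, and the protocol continues with `G i`. Recursion variables are natural numbers. -/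
inductive GlobalType (Pr Msg : Type*) where
  | done : GlobalType Pr Msg
  | choice (p : Pr) (n : ℕ) (q : Fin n → Pr) (m : Fin n → Msg) (G : Fin n → GlobalType Pr Msg) :
      GlobalType Pr Msg
  | mu (t : ℕ) (G : GlobalType Pr Msg) : GlobalType Pr Msg
  | var (t : ℕ) : GlobalType Pr Msg

namespace GlobalType

variable {Pr Msg : Type*}

/-- `Subterm H G`: `H` is a subterm of `G`. -/
inductive Subterm : GlobalType Pr Msg → GlobalType Pr Msg → Prop where
  | refl (G) : Subterm G G
  | choice {H p n q m} {G : Fin n → GlobalType Pr Msg} (i : Fin n) (h : Subterm H (G i)) :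
      Subterm H (choice p n q m G)
  | mu {H t G} (h : Subterm H G) : Subterm H (mu t G)

/-- The free recursion variables. -/
def freeVars : GlobalType Pr Msg → Set ℕ
  | done => ∅
  | choice _ _ _ _ G => ⋃ i, (G i).freeVars
  | mu t G => G.freeVars \ {t}
  | var t => {t}

/-- The variables bound in the type, with multiplicity, in order of occurrence. -/
def binders : GlobalType Pr Msg → List ℕ
  | done => []
  | choice _ _ _ _ G => (List.ofFn fun i => (G i).binders).flatten
  | mu t G => t :: G.binders
  | var _ => []

/-- The variables that occur without a message exchange in front of them. -/
def unguardedVars : GlobalType Pr Msg → Set ℕ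
  | done => ∅
  | choice _ _ _ _ _ => ∅
  | mu _ G => G.unguardedVars
  | var t => {t}

/-- The conditions imposed on global types: the branches of a choice are pairwise distinguishable,
no process sends a message to itself, recursion is guarded, all recursion variables are bound, and
every variable is bound at most once. -/
structure WellFormed (G : GlobalType Pr Msg) : Prop where
  distinguishable : ∀ p n q m H, Subterm (choice p n q m H) G →
    ∀ i j, i ≠ j → q i ≠ q j ∨ m i ≠ m j
  no_self_message : ∀ p n q m H, Subterm (choice p n q m H) G → ∀ i, p ≠ q i
  guarded : ∀ t H, Subterm (mu t H) G → t ∉ H.unguardedVars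
  closed : G.freeVars = ∅
  distinct : G.binders.Nodup

/-- The transitions of the automaton of the global type `G`, whose states are the subterms of `G`.
A message exchange produces the send event followed by the receive event; entering a recursion and
returning to its binder are silent. -/
inductive Step (G : GlobalType Pr Msg) :
    GlobalType Pr Msg → List (Event Pr Msg) → GlobalType Pr Msg → Prop where
  | exchange (p n q m H) (i : Fin n) :
      Step G (choice p n q m H) [Event.send p (q i) (m i), Event.recv p (q i) (m i)] (H i)
  | enter (t H) : Step G (mu t H) [] H
  | back (t H) (h : Subterm (mu t H) G) : Step G (var t) [] (mu t H)

/-- `Run G s w s'`: there is a finite run from `s` to `s'` with trace `w`. -/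
inductive Run (G : GlobalType Pr Msg) :
    GlobalType Pr Msg → List (Event Pr Msg) → GlobalType Pr Msg → Prop where
  | nil (s) : Run G s [] s
  | cons {s a s' w s''} (h : Step G s a s') (h' : Run G s' w s'') : Run G s (a ++ w) s''

/-- The type language of `G`: the traces of the runs from `G` that end in `0` or are infinite. -/
def language (G : GlobalType Pr Msg) : Set (Word (Event Pr Msg)) :=
  {w | (∃ u, w = Word.fin u ∧ Run G G u done) ∨
    (∃ (s : ℕ → GlobalType Pr Msg) (a : ℕ → List (Event Pr Msg)), s 0 = G ∧
      (∀ n, Step G (s n) (a n) (s (n + 1))) ∧ Word.IsConcat a w)}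

/-- The execution language of `G`. -/
def executionLanguage (G : GlobalType Pr Msg) : Set (Word (Event Pr Msg)) :=
  indistClosure G.language

end GlobalType

/-!
A word of the type language is a concatenation of exchanges, each a send immediately followed by
its reception, with distinct sender and receiver (`GlobalType.exists_isConcat_of_mem_language`).
The closure under indistinguishability keeps enough of this structure.

On words without self-messages, a swap changes neither the projections to the processes nor
channel compliance (`HasProjections.indist_iff`). Hence a word `w` of the execution language is
channel-compliant, and each process performs in every prefix of `w` an initial part of what it
performs in some fixed sequence of exchanges `b 0, b 1, …`: `w` follows `b` (`Follows`). The rest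
uses only this. As a process takes part in an exchange at most once, its `k`-th event in `w` comes
from a well-defined exchange (`Origin`). Along each process the exchange index increases strictly,
and it agrees for a send and its matching reception, because the `k`-th send and the `k`-th
reception of a channel belong to the same exchange (`Follows.origin_eq_of_matched`).

* Half-duplex: if messages were pending in both directions between `P` and `Q`, then one of them,
  say from `P` to `Q`, would belong to the earlier exchange. But `Q` receives it in `b` before
  sending the other one, and so also in `w`.
* Sorting the positions of `w` by exchange index, the send before the reception, respects the order
  of the message sequence chart and so gives a linearisation whose pieces are the parts of the
  exchanges that occur in `w` (`Follows.exists_linearisation`). This is the linearisation required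
  for synchronisability.
* If every send of `w` is matched, then each exchange occurs completely or not at all, so that the
  same linearisation is `1`-bounded. A finite word of the execution language is indistinguishable
  from a sequence of complete exchanges, so that in it every send is matched
  (`allMatched_of_indist`).
-/

/-! ### Infinite concatenations -/

namespace Word

variable {α : Type*}

/-- The concatenation of the first `n` pieces of a sequence of lists. -/
def joined (b : ℕ → List α) (n : ℕ) : List α :=
  ((List.range n).map b).flatten

@[simp]
theorem joined_zero (b : ℕ → List α) : joined b 0 = [] := rfl

theorem joined_succ (b : ℕ → List α) (n : ℕ) : joined b (n + 1) = joined b n ++ b n := by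
  simp [joined, List.range_succ]

theorem joined_succ' (b : ℕ → List α) (n : ℕ) :
    joined b (n + 1) = b 0 ++ joined (fun i => b (i + 1)) n := by
  simp [joined, List.range_succ_eq_map, Function.comp_def]

theorem joined_prefix (b : ℕ → List α) {m n : ℕ} (h : m ≤ n) : joined b m <+: joined b n := by
  induction n, h using Nat.le_induction with
  | base => exact List.prefix_rfl
  | succ n _ ih =>
    rw [joined_succ]
    exact ih.trans (List.prefix_append _ _)

theorem joined_pair (c : ℕ → List α) (n : ℕ) :
    joined (fun i => c (2 * i) ++ c (2 * i + 1)) n = joined c (2 * n) := by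
  induction n with
  | zero => rfl
  | succ n ih =>
    rw [joined_succ, ih, Nat.mul_succ, joined_succ, joined_succ, List.append_assoc]

theorem take_prefix_take (w : Word α) {m n : ℕ} (h : m ≤ n) : w.take m <+: w.take n := by
  simpa using filterMap_take_mono some w h

theorem length_take_le (w : Word α) (n : ℕ) : (w.take n).length ≤ n := by
  cases w <;> simp [take]

theorem getElem?_take (w : Word α) {i n : ℕ} (h : i < n) : (w.take n)[i]? = w.nth i := by
  cases w with
  | fin l => simp [take, nth, h]
  | inf f => simp [take, nth, h]

theorem take_map {β : Type*} (g : α → β) (w : Word α) (n : ℕ) :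
    (w.map g).take n = (w.take n).map g := by
  cases w <;> simp [take, map, List.map_take]

theorem exists_isConcat (b : ℕ → List α) : ∃ w, IsConcat b w := by
  by_cases h : ∃ N, ∀ n ≥ N, b n = []
  · obtain ⟨N, hN⟩ := h
    have hpre : ∀ n, joined b n <+: joined b N := by
      intro n
      rcases Nat.le_total n N with hn | hn
      · exact joined_prefix b hn
      · have : joined b n = joined b N := by
          induction n, hn using Nat.le_induction with
          | base => rfl
          | succ n hn ih => rw [joined_succ, hN n hn, List.append_nil, ih]
        rw [this]
    exact ⟨fin (joined b N), fun n => ⟨_, List.prefix_iff_eq_take.1 (hpre n)⟩,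
      fun k => ⟨N, List.take_prefix _ _⟩⟩
  · push Not at h
    have hlong : ∀ i, ∃ n, i < (joined b n).length := by
      intro i
      induction i with
      | zero =>
        obtain ⟨n, -, hn⟩ := h 0
        refine ⟨n + 1, ?_⟩
        have := List.length_pos_iff.2 hn
        rw [joined_succ, List.length_append]
        omega
      | succ i ih =>
        obtain ⟨n, hn⟩ := ih
        obtain ⟨n', hle, hn'⟩ := h n
        refine ⟨n' + 1, ?_⟩
        have := List.length_pos_iff.2 hn'
        have := (joined_prefix b hle).length_le
        rw [joined_succ, List.length_append]
        omega
    choose N hN using hlong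
    have hjoin : ∀ n, joined b n =
        (inf fun i => (joined b (N i))[i]'(hN i)).take (joined b n).length := by
      intro n
      refine List.ext_getElem (by simp [take]) fun i h1 h2 => ?_
      simp only [take, List.getElem_map, List.getElem_range]
      rcases Nat.le_total n (N i) with hn | hn
      · exact (joined_prefix b hn).getElem h1
      · exact ((joined_prefix b hn).getElem (hN i)).symm
    refine ⟨_, fun n => ⟨_, hjoin n⟩, fun k => ⟨N k, ?_⟩⟩
    change _ <+: joined b (N k)
    rw [hjoin (N k)]
    exact take_prefix_take _ (hN k).le

theorem exists_of_getElem?_joined {c : ℕ → List α} (hc : ∀ k, (c k).length ≤ 1) {n i : ℕ} {e : α}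
    (h : (joined c n)[i]? = some e) : ∃ k, c k = [e] ∧ i = (joined c k).length := by
  induction n with
  | zero => simp at h
  | succ n ih =>
    rw [joined_succ, List.getElem?_append] at h
    split_ifs at h with hi
    · exact ih h
    · have hlt := (List.getElem?_eq_some_iff.1 h).1
      have h1 := hc n
      have h0 : i - (joined c n).length = 0 := by omega
      rw [h0] at h
      refine ⟨n, ?_, by omega⟩
      match hcn : c n, h1 with
      | [], _ => simp [hcn] at h
      | [x], _ => simpa [hcn] using h

/-- The positions of a concatenation of pieces of length at most one. -/
theorem IsConcat.nth_eq_some_iff {c : ℕ → List α} (hc : ∀ k, (c k).length ≤ 1) {u : Word α}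
    (hu : IsConcat c u) {i : ℕ} {e : α} :
    u.nth i = some e ↔ ∃ k, c k = [e] ∧ i = (joined c k).length := by
  constructor
  · intro h
    obtain ⟨n, hn⟩ := hu.2 (i + 1)
    change _ <+: joined c n at hn
    rw [← getElem?_take u (Nat.lt_succ_self i)] at h
    obtain ⟨hlt, he⟩ := List.getElem?_eq_some_iff.1 h
    refine exists_of_getElem?_joined hc (n := n) (i := i) ?_
    rw [← he, hn.getElem hlt]
    exact List.getElem?_eq_getElem _
  · rintro ⟨k, hk, rfl⟩
    obtain ⟨m, hm⟩ := hu.1 (k + 1)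
    change joined c (k + 1) = _ at hm
    rw [joined_succ, hk] at hm
    have hlen := congrArg List.length hm
    have := length_take_le u m
    rw [List.length_append, List.length_singleton] at hlen
    rw [← getElem?_take u (show (joined c k).length < m by omega), ← hm]
    simp

open Classical in
/-- The list of all elements with a given key, for an injective `key`. -/
noncomputable def slot (key : α → ℕ) (k : ℕ) : List α :=
  if h : ∃ e, key e = k then [h.choose] else []

theorem length_slot_le (key : α → ℕ) (k : ℕ) : (slot key k).length ≤ 1 := by
  unfold slot
  split_ifs <;> simp

theorem mem_slot_iff {key : α → ℕ} (hkey : Function.Injective key) {k : ℕ} {e : α} :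
    e ∈ slot key k ↔ key e = k := by
  unfold slot
  split_ifs with h
  · rw [List.mem_singleton]
    constructor
    · rintro rfl
      exact h.choose_spec
    · intro he
      exact hkey (he.trans h.choose_spec.symm)
  · simpa using fun he => h ⟨e, he⟩

theorem slot_eq_singleton_iff {key : α → ℕ} (hkey : Function.Injective key) {k : ℕ} {e : α} :
    slot key k = [e] ↔ key e = k := by
  rw [← mem_slot_iff hkey]
  constructor
  · intro h
    simp [h]
  · intro h
    match hs : slot key k, length_slot_le key k with
    | [], _ => simp [hs] at h
    | [x], _ => simp_all

/-- Elements with distinct natural number keys can be listed by increasing key. -/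
theorem exists_sorted {key : α → ℕ} (hkey : Function.Injective key) :
    ∃ u : Word α, IsConcat (slot key) u ∧ (∀ e, ∃! i, u.nth i = some e) ∧
      ∀ i j e e', u.nth i = some e → u.nth j = some e' → key e ≤ key e' → i ≤ j := by
  obtain ⟨u, hu⟩ := exists_isConcat (slot key)
  have hnth : ∀ i e, u.nth i = some e ↔ i = (joined (slot key) (key e)).length := by
    intro i e
    simp [hu.nth_eq_some_iff (length_slot_le key), slot_eq_singleton_iff hkey]
  refine ⟨u, hu, fun e => ⟨_, (hnth _ _).2 rfl, fun i hi => (hnth _ _).1 hi⟩, ?_⟩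
  intro i j e e' hi hj hle
  rw [(hnth _ _).1 hi, (hnth _ _).1 hj]
  exact (joined_prefix _ hle).length_le

end Word

/-! ### Projections to processes, and indistinguishability -/

section Projection

variable {Pr Msg : Type*}

open Classical in
/-- The events of `u` that are performed by `p`. -/
noncomputable def proj (p : Pr) (u : List (Event Pr Msg)) : List (Event Pr Msg) :=
  u.filter fun e => e.actor = p

@[simp]
theorem proj_append (p : Pr) (u v : List (Event Pr Msg)) :
    proj p (u ++ v) = proj p u ++ proj p v := by
  simp [proj]

@[simp]
theorem sent_append (P Q : Pr) (u v : List (Event Pr Msg)) :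
    sent P Q (u ++ v) = sent P Q u ++ sent P Q v := by
  simp [sent]

@[simp]
theorem received_append (P Q : Pr) (u v : List (Event Pr Msg)) :
    received P Q (u ++ v) = received P Q u ++ received P Q v := by
  simp [received]

theorem proj_prefix {u v : List (Event Pr Msg)} (h : u <+: v) (p : Pr) : proj p u <+: proj p v :=
  h.filter _

theorem sent_prefix {u v : List (Event Pr Msg)} (h : u <+: v) (P Q : Pr) :
    sent P Q u <+: sent P Q v :=
  h.filterMap _

theorem received_prefix {u v : List (Event Pr Msg)} (h : u <+: v) (P Q : Pr) :
    received P Q u <+: received P Q v :=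
  h.filterMap _

theorem sent_proj (P Q : Pr) (u : List (Event Pr Msg)) : sent P Q (proj P u) = sent P Q u := by
  unfold sent proj
  rw [List.filterMap_filter]
  congr 1
  funext e
  cases e with
  | send p q m => by_cases h : p = P <;> simp [Event.actor, Event.sendMsg, h]
  | recv p q m => simp [Event.sendMsg]

theorem received_proj (P Q : Pr) (u : List (Event Pr Msg)) :
    received P Q (proj Q u) = received P Q u := by
  unfold received proj
  rw [List.filterMap_filter]
  congr 1
  funext e
  cases e with
  | send p q m => simp [Event.recvMsg]
  | recv p q m => by_cases h : q = Q <;> simp [Event.actor, Event.recvMsg, h]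

@[simp]
theorem sent_nil (P Q : Pr) : sent P Q ([] : List (Event Pr Msg)) = [] := rfl

@[simp]
theorem received_nil (P Q : Pr) : received P Q ([] : List (Event Pr Msg)) = [] := rfl

open Classical in
@[simp]
theorem sent_cons_send (P Q p q : Pr) (m : Msg) (u : List (Event Pr Msg)) :
    sent P Q (Event.send p q m :: u) = if p = P ∧ q = Q then m :: sent P Q u else sent P Q u := by
  by_cases h : p = P ∧ q = Q <;> simp [sent, Event.sendMsg, h]

@[simp]
theorem sent_cons_recv (P Q p q : Pr) (m : Msg) (u : List (Event Pr Msg)) :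
    sent P Q (Event.recv p q m :: u) = sent P Q u := rfl

@[simp]
theorem received_cons_send (P Q p q : Pr) (m : Msg) (u : List (Event Pr Msg)) :
    received P Q (Event.send p q m :: u) = received P Q u := rfl

open Classical in
@[simp]
theorem received_cons_recv (P Q p q : Pr) (m : Msg) (u : List (Event Pr Msg)) :
    received P Q (Event.recv p q m :: u) =
      if p = P ∧ q = Q then m :: received P Q u else received P Q u := by
  by_cases h : p = P ∧ q = Q <;> simp [received, Event.recvMsg, h]

/-- Channel compliance for finite words, phrased with prefixes. -/
def Compliant (u : List (Event Pr Msg)) : Prop :=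
  ∀ x, x <+: u → ∀ P Q, received P Q x <+: sent P Q x

/-- No process sends a message to itself or receives one from itself. -/
def NoSelfMessage (u : List (Event Pr Msg)) : Prop :=
  ∀ p m, Event.send p p m ∉ u ∧ Event.recv p p m ∉ u

/-- Swapping two neighbouring events with independent effects keeps a word compliant, as soon as the
only new prefix does not receive too early. -/
theorem Compliant.swap {w u : List (Event Pr Msg)} {a b : Event Pr Msg}
    (h : Compliant (w ++ a :: b :: u))
    (hs : ∀ P Q, sent P Q [a, b] = sent P Q [b, a])
    (hr : ∀ P Q, received P Q [a, b] = received P Q [b, a])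
    (hb : ∀ P Q, received P Q (w ++ [b]) <+: sent P Q (w ++ [b])) :
    Compliant (w ++ b :: a :: u) := by
  intro x hx P Q
  have hw : ∀ y, y <+: u → received P Q (w ++ [b, a] ++ y) <+: sent P Q (w ++ [b, a] ++ y) := by
    intro y hy
    have h1 := h (w ++ [a, b] ++ y) (by simpa using hy) P Q
    simpa only [sent_append, received_append, hs, hr] using h1
  rcases le_or_gt x.length w.length with hlen | hlen
  · exact h x ((List.prefix_of_prefix_length_le hx (List.prefix_append _ _) hlen).trans
      (List.prefix_append _ _)) P Q
  · obtain ⟨y, rfl⟩ := List.prefix_of_prefix_length_le (List.prefix_append w _) hx hlen.le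
    rw [List.prefix_append_right_inj] at hx
    match y with
    | [] => simp at hlen
    | [c] =>
      have : c = b := by simpa using hx
      exact this ▸ hb P Q
    | c :: d :: y =>
      simp only [List.cons_prefix_cons] at hx
      obtain ⟨rfl, rfl, hy⟩ := hx
      simpa using hw y hy

/-- The properties of a word `u` that are invariant under indistinguishability: no self-messages,
compliance, and the given projections `π`. -/
structure HasProjections (π : Pr → List (Event Pr Msg)) (u : List (Event Pr Msg)) : Prop where
  noSelf : NoSelfMessage u
  compliant : Compliant u
  proj_eq : ∀ p, proj p u = π p

theorem HasProjections.swap {π : Pr → List (Event Pr Msg)} {w u : List (Event Pr Msg)}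
    {a b : Event Pr Msg} (h : HasProjections π (w ++ a :: b :: u)) (hab : a.actor ≠ b.actor)
    (hb : ∀ P Q, received P Q (w ++ [b]) <+: sent P Q (w ++ [b])) :
    HasProjections π (w ++ b :: a :: u) := by
  have hp : ∀ p, proj p [a, b] = proj p [b, a] := by
    intro p
    by_cases h1 : a.actor = p
    · have h2 : b.actor ≠ p := fun h2 => hab (h1.trans h2.symm)
      simp [proj, h1, h2]
    · simp [proj, List.filter_cons, h1]
  refine ⟨fun p m => ?_, h.compliant.swap ?_ ?_ hb, fun p => ?_⟩
  · have := h.noSelf p m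
    simp only [List.mem_append, List.mem_cons] at this ⊢
    tauto
  · intro P Q
    rw [← sent_proj, hp, sent_proj]
  · intro P Q
    rw [← received_proj, hp, received_proj]
  · rw [← h.proj_eq p]
    have hsplit : ∀ c d : Event Pr Msg,
        proj p (w ++ c :: d :: u) = proj p w ++ proj p [c, d] ++ proj p u := by
      intro c d
      simp [← proj_append]
    rw [hsplit, hsplit, hp]

theorem HasProjections.swap_iff {π : Pr → List (Event Pr Msg)} {u v : List (Event Pr Msg)}
    (h : Swap u v) : HasProjections π u ↔ HasProjections π v := by
  -- the new prefix ends with a send, which can only help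
  have hsend : ∀ {w x : List (Event Pr Msg)} {P Q m}, HasProjections π (w ++ x) →
      ∀ P' Q', received P' Q' (w ++ [Event.send P Q m]) <+:
        sent P' Q' (w ++ [Event.send P Q m]) := by
    intro w x P Q m h P' Q'
    have h1 := h.compliant w (List.prefix_append _ _) P' Q'
    rw [received_append, sent_append]
    simpa using h1.trans (List.prefix_append _ _)
  -- the new prefix ends with a reception that followed another reception
  have hrecv : ∀ {w x : List (Event Pr Msg)} {P Q m R S m'},
      HasProjections π (w ++ Event.recv P Q m :: Event.recv R S m' :: x) → Q ≠ S →
      ∀ P' Q', received P' Q' (w ++ [Event.recv R S m']) <+: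
        sent P' Q' (w ++ [Event.recv R S m']) := by
    intro w x P Q m R S m' h hne P' Q'
    have h1 := h.compliant (w ++ [Event.recv P Q m, Event.recv R S m']) (by simp) P' Q'
    have h2 := h.compliant w (List.prefix_append _ _) P' Q'
    by_cases hc : R = P' ∧ S = Q'
    · obtain ⟨rfl, rfl⟩ := hc
      simpa [hne] using h1
    · simpa [hc] using h2
  cases h with
  | send_send w u P Q R S m m' hne =>
    exact ⟨fun h => h.swap hne (hsend h), fun h => h.swap hne.symm (hsend h)⟩
  | recv_recv w u P Q R S m m' hne =>
    exact ⟨fun h => h.swap hne (hrecv h hne), fun h => h.swap hne.symm (hrecv h hne.symm)⟩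
  | send_recv w u P Q R S m m' hne =>
    refine ⟨fun h => h.swap hne.1 fun P' Q' => ?_, fun h => h.swap hne.1.symm (hsend h)⟩
    have h1 := h.compliant (w ++ [Event.send P Q m, Event.recv R S m']) (by simp) P' Q'
    have h2 := h.compliant w (List.prefix_append _ _) P' Q'
    by_cases hc : R = P' ∧ S = Q'
    · obtain ⟨rfl, rfl⟩ := hc
      have hc' : ¬ (P = R ∧ Q = S) := by tauto
      simpa [hc'] using h1
    · simpa [hc] using h2
  | same_channel w u P Q m m' hlt =>
    have hne : ∀ {x}, HasProjections π x → Event.send P Q m ∈ x → P ≠ Q := by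
      rintro x h hm rfl
      exact (h.noSelf P m).1 hm
    refine ⟨fun h => h.swap (hne h (by simp)) fun P' Q' => ?_,
      fun h => h.swap (hne h (by simp)).symm (hsend h)⟩
    have h1 := h.compliant (w ++ [Event.send P Q m, Event.recv P Q m']) (by simp) P' Q'
    have h2 := h.compliant w (List.prefix_append _ _) P' Q'
    by_cases hc : P = P' ∧ Q = Q'
    · obtain ⟨rfl, rfl⟩ := hc
      -- the pending message in the channel is the one received, so `m` is not needed yet
      have h3 : received P Q (w ++ [Event.recv P Q m']) <+: sent P Q w ++ [m] := by
        simpa using h1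
      have h4 := List.prefix_of_prefix_length_le h3 (List.prefix_append _ _)
        (by simpa using hlt)
      simpa using h4
    · simpa [hc] using h2

theorem HasProjections.indist_iff {π : Pr → List (Event Pr Msg)} {u v : List (Event Pr Msg)}
    (h : Indist u v) : HasProjections π u ↔ HasProjections π v := by
  induction h with
  | rel _ _ h => exact swap_iff h
  | refl => exact Iff.rfl
  | symm _ _ _ ih => exact ih.symm
  | trans _ _ _ _ _ ih₁ ih₂ => exact ih₁.trans ih₂

theorem Swap.append_right {u v : List (Event Pr Msg)} (h : Swap u v) (x : List (Event Pr Msg)) :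
    Swap (u ++ x) (v ++ x) := by
  cases h <;> simp only [List.append_assoc, List.cons_append]
  · exact Swap.send_send _ _ _ _ _ _ _ _ ‹_›
  · exact Swap.recv_recv _ _ _ _ _ _ _ _ ‹_›
  · exact Swap.send_recv _ _ _ _ _ _ _ _ ‹_›
  · exact Swap.same_channel _ _ _ _ _ _ ‹_›

theorem Indist.append_right {u v : List (Event Pr Msg)} (h : Indist u v)
    (x : List (Event Pr Msg)) : Indist (u ++ x) (v ++ x) := by
  induction h with
  | rel _ _ h => exact .rel _ _ (h.append_right x)
  | refl => exact .refl _
  | symm _ _ _ ih => exact .symm _ _ ih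
  | trans _ _ _ _ _ ih₁ ih₂ => exact .trans _ _ _ ih₁ ih₂

end Projection

/-! ### Sequences of message exchanges -/

section Exchanges

variable {Pr Msg : Type*}

open Word

/-- Every piece is empty or consists of a send event between distinct processes, followed by its
reception. -/
def IsExchangeSequence (b : ℕ → List (Event Pr Msg)) : Prop :=
  ∀ n, b n = [] ∨ ∃ p q m, p ≠ q ∧ b n = [Event.send p q m, Event.recv p q m]

namespace IsExchangeSequence

variable {b : ℕ → List (Event Pr Msg)}

theorem noSelfMessage (hb : IsExchangeSequence b) (n : ℕ) : NoSelfMessage (joined b n) := by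
  intro r m
  induction n with
  | zero => simp
  | succ n ih =>
    rw [joined_succ]
    rcases hb n with h | ⟨p, q, m', hpq, h⟩
    · simpa [h] using ih
    · simp only [h, List.mem_append, List.mem_cons, Event.send.injEq, Event.recv.injEq,
        reduceCtorEq, List.not_mem_nil, or_false, false_or, not_or]
      refine ⟨⟨ih.1, ?_⟩, ih.2, ?_⟩
      all_goals
        rintro ⟨rfl, rfl, -⟩
        exact hpq rfl

theorem sent_eq_received (hb : IsExchangeSequence b) (n : ℕ) (P Q : Pr) :
    sent P Q (joined b n) = received P Q (joined b n) := by
  induction n with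
  | zero => rfl
  | succ n ih =>
    rw [joined_succ, sent_append, received_append, ih]
    rcases hb n with h | ⟨p, q, m, -, h⟩ <;> simp [h]

/-- A prefix ends between two exchanges or in the middle of one. -/
theorem eq_of_prefix (hb : IsExchangeSequence b) {n : ℕ} {x : List (Event Pr Msg)}
    (hx : x <+: joined b n) :
    ∃ k, x = joined b k ∨ ∃ p q m, x = joined b k ++ [Event.send p q m] := by
  induction n with
  | zero => exact ⟨0, Or.inl (by simpa using hx)⟩
  | succ n ih =>
    rcases le_or_gt x.length (joined b n).length with hlen | hlen
    · exact ih (List.prefix_of_prefix_length_le hx (joined_prefix b n.le_succ) hlen)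
    · obtain ⟨y, rfl⟩ := List.prefix_of_prefix_length_le (joined_prefix b n.le_succ) hx hlen.le
      rw [joined_succ, List.prefix_append_right_inj] at hx
      rcases hb n with h | ⟨p, q, m, -, h⟩
      · rw [h, List.prefix_nil] at hx
        exact ⟨n, Or.inl (by simp [hx])⟩
      · rw [h] at hx
        match y with
        | [] => simp at hlen
        | [c] =>
          have hc : c = Event.send p q m := by simpa using hx
          exact ⟨n, Or.inr ⟨p, q, m, by rw [hc]⟩⟩
        | c :: d :: y =>
          simp only [List.cons_prefix_cons, List.prefix_nil] at hx
          obtain ⟨rfl, rfl, rfl⟩ := hx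
          exact ⟨n + 1, Or.inl (by rw [joined_succ, h])⟩

theorem compliant (hb : IsExchangeSequence b) (n : ℕ) : Compliant (joined b n) := by
  intro x hx P Q
  obtain ⟨k, rfl | ⟨p, q, m, rfl⟩⟩ := hb.eq_of_prefix hx
  · rw [hb.sent_eq_received]
  · rw [received_append, sent_append, hb.sent_eq_received]
    simp

theorem length_sent_le (hb : IsExchangeSequence b) {n : ℕ} {x : List (Event Pr Msg)}
    (hx : x <+: joined b n) (P Q : Pr) :
    (sent P Q x).length ≤ (received P Q x).length + 1 := by
  obtain ⟨k, rfl | ⟨p, q, m, rfl⟩⟩ := hb.eq_of_prefix hx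
  · rw [hb.sent_eq_received]
    omega
  · rw [received_append, sent_append, hb.sent_eq_received]
    by_cases h : p = P ∧ q = Q <;> simp [h]

theorem proj_block (hb : IsExchangeSequence b) {n : ℕ} {e : Event Pr Msg} (he : e ∈ b n) :
    proj e.actor (b n) = [e] := by
  rcases hb n with h | ⟨p, q, m, hpq, h⟩
  · simp [h] at he
  · rw [h] at he ⊢
    rcases List.mem_pair.1 he with rfl | rfl
    · simp [proj, Event.actor, hpq.symm]
    · simp [proj, Event.actor, hpq]

theorem block_eq (hb : IsExchangeSequence b) {n : ℕ} {P Q : Pr} {m : Msg}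
    (h : Event.send P Q m ∈ b n ∨ Event.recv P Q m ∈ b n) :
    P ≠ Q ∧ b n = [Event.send P Q m, Event.recv P Q m] := by
  rcases hb n with h' | ⟨p, q, m', hpq, h'⟩
  · simp [h'] at h
  · rw [h'] at h ⊢
    simp at h
    obtain ⟨rfl, rfl, rfl⟩ := h
    exact ⟨hpq, rfl⟩

end IsExchangeSequence

/-! ### Words that follow a sequence of exchanges -/

/-- The word `w` is channel-compliant, and what each process does in a prefix of `w` is an initial
part of what it does in the exchanges `b 0, b 1, …`. -/
structure Follows (w : Word (Event Pr Msg)) (b : ℕ → List (Event Pr Msg)) : Prop where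
  exchanges : IsExchangeSequence b
  channelCompliant : w.ChannelCompliant
  proj_prefix : ∀ k p, ∃ n, proj p (w.take k) <+: proj p (joined b n)

/-- The event at position `i` of `w` stems from the exchange `b n`: it occurs in `b n`, and its
process has done the same before position `i` of `w` as before `b n`. -/
def Origin (w : Word (Event Pr Msg)) (b : ℕ → List (Event Pr Msg)) (i n : ℕ) : Prop :=
  ∃ e, w.nth i = some e ∧ e ∈ b n ∧ proj e.actor (w.take i) = proj e.actor (joined b n)

theorem Word.proj_take_succ {w : Word (Event Pr Msg)} {i : ℕ} {e : Event Pr Msg}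
    (h : w.nth i = some e) : proj e.actor (w.take (i + 1)) = proj e.actor (w.take i) ++ [e] := by
  simp [Word.take_add_one, h, proj]

theorem Origin.sent_eq {w : Word (Event Pr Msg)} {b : ℕ → List (Event Pr Msg)} {i n : ℕ}
    (h : Origin w b i n) {e : Event Pr Msg} (he : w.nth i = some e) (Q : Pr) :
    sent e.actor Q (w.take i) = sent e.actor Q (joined b n) := by
  obtain ⟨e', he', -, hp⟩ := h
  cases he.symm.trans he'
  rw [← sent_proj, hp, sent_proj]

theorem Origin.received_eq {w : Word (Event Pr Msg)} {b : ℕ → List (Event Pr Msg)} {i n : ℕ}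
    (h : Origin w b i n) {e : Event Pr Msg} (he : w.nth i = some e) (P : Pr) :
    received P e.actor (w.take i) = received P e.actor (joined b n) := by
  obtain ⟨e', he', -, hp⟩ := h
  cases he.symm.trans he'
  rw [← received_proj, hp, received_proj]

theorem Origin.mem {w : Word (Event Pr Msg)} {b : ℕ → List (Event Pr Msg)} {i n : ℕ}
    (h : Origin w b i n) {e : Event Pr Msg} (he : w.nth i = some e) : e ∈ b n := by
  obtain ⟨e', he', hm, -⟩ := h
  cases he.symm.trans he'
  exact hm

namespace Follows

variable {w : Word (Event Pr Msg)} {b : ℕ → List (Event Pr Msg)}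

theorem exists_origin (h : Follows w b) {i : ℕ} {e : Event Pr Msg} (he : w.nth i = some e) :
    ∃ n, Origin w b i n := by
  obtain ⟨N, hN⟩ := h.proj_prefix (i + 1) e.actor
  rw [proj_take_succ he] at hN
  induction N with
  | zero => simp [proj] at hN
  | succ N ih =>
    by_cases hN' : proj e.actor (w.take i) ++ [e] <+: proj e.actor (joined b N)
    · exact ih hN'
    · rw [joined_succ, proj_append] at hN
      match hb : proj e.actor (b N) with
      | [] =>
        rw [hb, List.append_nil] at hN
        exact absurd hN hN'
      | e' :: l =>
        have hmem : e' ∈ proj e.actor (b N) := by simp [hb]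
        have hact : e'.actor = e.actor ∧ e' ∈ b N := by
          simp only [proj, List.mem_filter, decide_eq_true_eq] at hmem
          exact hmem.symm
        have hone := h.exchanges.proj_block hact.2
        rw [hact.1] at hone
        rw [hone] at hN
        rcases List.prefix_concat_iff.1 hN with h' | h'
        · have h2 := List.append_inj' h' rfl
          have h3 : e = e' := by simpa using h2.2
          exact ⟨N, e, he, h3 ▸ hact.2, h2.1⟩
        · exact absurd h' hN'

theorem length_proj_lt (h : Follows w b) {n n' : ℕ} {e : Event Pr Msg} (he : e ∈ b n)
    (hlt : n < n') : (proj e.actor (joined b n)).length < (proj e.actor (joined b n')).length := by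
  have h1 := (_root_.proj_prefix (joined_prefix b (Nat.succ_le_of_lt hlt)) e.actor).length_le
  rw [Nat.succ_eq_add_one, joined_succ, proj_append, h.exchanges.proj_block he] at h1
  simp at h1
  omega

/-- Each process takes part in the exchanges in the same order as in `w`. -/
theorem origin_mono (h : Follows w b) {i j n n' : ℕ} {e e' : Event Pr Msg}
    (he : w.nth i = some e) (he' : w.nth j = some e') (hact : e.actor = e'.actor)
    (hn : Origin w b i n) (hn' : Origin w b j n') (hij : i ≤ j) : n ≤ n' := by
  by_contra! hlt
  obtain ⟨_, h1, -, hp⟩ := hn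
  cases he.symm.trans h1
  obtain ⟨_, h1', hm, hp'⟩ := hn'
  cases he'.symm.trans h1'
  have h2 := h.length_proj_lt hm hlt
  rw [← hp', ← hact, ← hp] at h2
  have h3 := (_root_.proj_prefix (take_prefix_take w hij) e.actor).length_le
  omega

theorem origin_strictMono (h : Follows w b) {i j n n' : ℕ} {e e' : Event Pr Msg}
    (he : w.nth i = some e) (he' : w.nth j = some e') (hact : e.actor = e'.actor)
    (hn : Origin w b i n) (hn' : Origin w b j n') (hij : i < j) : n < n' := by
  refine lt_of_le_of_ne (h.origin_mono he he' hact hn hn' hij.le) ?_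
  rintro rfl
  obtain ⟨_, h1, -, hp⟩ := hn
  cases he.symm.trans h1
  obtain ⟨_, h1', -, hp'⟩ := hn'
  cases he'.symm.trans h1'
  have h3 := (_root_.proj_prefix (take_prefix_take w (Nat.succ_le_of_lt hij)) e.actor).length_le
  rw [Nat.succ_eq_add_one, proj_take_succ he, hp, hact, hp'] at h3
  simp at h3

/-- A send and its matching reception stem from the same exchange. -/
theorem origin_eq_of_matched (h : Follows w b) {i j n n' : ℕ} (hm : w.Matched i j)
    (hn : Origin w b i n) (hn' : Origin w b j n') : n = n' := by
  obtain ⟨P, Q, m, hi, hj, -, heq⟩ := hm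
  rw [sent_take_succ hi, received_take_succ hj] at heq
  have h1 : sent P Q (w.take i) = sent P Q (joined b n) := hn.sent_eq hi Q
  have h2 : received P Q (w.take j) = received P Q (joined b n') := hn'.received_eq hj P
  rw [h1, h2, ← h.exchanges.sent_eq_received] at heq
  have hlen := congrArg List.length (List.append_cancel_right heq)
  have key : ∀ {k k'}, b k = [Event.send P Q m, Event.recv P Q m] → k < k' →
      (sent P Q (joined b k)).length < (sent P Q (joined b k')).length := by
    intro k k' hk hlt
    have h1 := (sent_prefix (joined_prefix b (Nat.succ_le_of_lt hlt)) P Q).length_le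
    rw [Nat.succ_eq_add_one, joined_succ, hk] at h1
    simp at h1
    omega
  rcases lt_trichotomy n n' with hlt | rfl | hlt
  · have := key (h.exchanges.block_eq (Or.inl (hn.mem hi))).2 hlt
    omega
  · rfl
  · have := key (h.exchanges.block_eq (Or.inr (hn'.mem hj))).2 hlt
    omega

/-- A pending message was sent in an exchange before which exactly the messages received so far
have been sent. -/
theorem exists_pending (h : Follows w b) {k : ℕ} {P Q : Pr}
    (hne : sent P Q (w.take k) ≠ received P Q (w.take k)) :
    ∃ i < k, ∃ n m, w.nth i = some (Event.send P Q m) ∧ Origin w b i n ∧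
      received P Q (w.take k) = received P Q (joined b n) := by
  obtain ⟨t, ht⟩ := h.channelCompliant k P Q
  match t with
  | [] => exact absurd (by simpa using ht.symm) hne
  | m :: t =>
    obtain ⟨i, hik, hi, heq⟩ := exists_reach (Event.sendMsg P Q) w k (received P Q (w.take k)) m
      ⟨t, by simpa [sent] using ht⟩
    have hi := bind_sendMsg hi
    obtain ⟨n, hn⟩ := h.exists_origin hi
    refine ⟨i, hik, n, m, hi, hn, ?_⟩
    have h1 : sent P Q (w.take i) = sent P Q (joined b n) := hn.sent_eq hi Q
    have h2 := (sent_take_succ hi).symm.trans heq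
    rw [← List.append_cancel_right h2, h1, h.exchanges.sent_eq_received]

theorem halfDuplex (h : Follows w b) : w.HalfDuplex := by
  -- the process that sends in the later exchange has already received the other pending message
  have key : ∀ {k P Q i n m i' n' m'}, w.nth i = some (Event.send P Q m) → Origin w b i n →
      received P Q (w.take k) = received P Q (joined b n) → i' < k →
      w.nth i' = some (Event.send Q P m') → Origin w b i' n' → n' ≤ n := by
    intro k P Q i n m i' n' m' hi hn hrec hik hi' hn'
    by_contra! hlt
    have h1 : received P Q (w.take i') = received P Q (joined b n') := hn'.received_eq hi' P
    have h2 := (received_prefix (joined_prefix b (Nat.succ_le_of_lt hlt)) P Q).length_le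
    rw [Nat.succ_eq_add_one, joined_succ, (h.exchanges.block_eq (Or.inl (hn.mem hi))).2] at h2
    have h3 := (received_prefix (take_prefix_take w hik.le) P Q).length_le
    rw [hrec, h1] at h3
    simp at h2
    omega
  intro k P Q
  by_contra! hne
  obtain ⟨i, hik, n, m, hi, hn, hrec⟩ := h.exists_pending hne.1
  obtain ⟨i', hik', n', m', hi', hn', hrec'⟩ := h.exists_pending hne.2
  obtain rfl : n = n' := le_antisymm (key hi' hn' hrec' hik hi hn) (key hi hn hrec hik' hi' hn')
  obtain ⟨hPQ, hblock⟩ := h.exchanges.block_eq (Or.inl (hn.mem hi))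
  have hmem := hn'.mem hi'
  rw [hblock] at hmem
  simp at hmem
  exact hPQ hmem.2.1

end Follows

end Exchanges

/-! ### Linearisations by exchanges -/

section Linearisation

variable {Pr Msg : Type*}

open Word

/-- The positions of a word, i.e. the event nodes of its prefix message sequence chart. -/
abbrev Word.Pos (w : Word (Event Pr Msg)) : Type := {i : ℕ // (w.nth i).isSome}

/-- The event at a position. -/
def Word.eventAt (w : Word (Event Pr Msg)) (e : w.Pos) : Event Pr Msg := (w.nth e).get e.2

theorem Word.nth_pos (w : Word (Event Pr Msg)) (e : w.Pos) : w.nth e = some (w.eventAt e) :=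
  (Option.some_get e.2).symm

theorem Word.eventAt_eq {w : Word (Event Pr Msg)} {e : w.Pos} {a : Event Pr Msg}
    (h : w.nth e = some a) : w.eventAt e = a := by
  simpa [nth_pos] using h

namespace Follows

variable {w : Word (Event Pr Msg)} {b : ℕ → List (Event Pr Msg)}

/-- The index of the exchange from which the event at a position stems. -/
noncomputable def exchangeOf (h : Follows w b) (e : w.Pos) : ℕ :=
  (h.exists_origin (w.nth_pos e)).choose

theorem origin_exchangeOf (h : Follows w b) (e : w.Pos) : Origin w b e (h.exchangeOf e) :=
  (h.exists_origin (w.nth_pos e)).choose_spec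

open Classical in
/-- The place of an event in the linearisation: the send and the reception of `b n` get the keys
`2 * n` and `2 * n + 1`. -/
noncomputable def key (h : Follows w b) (e : w.Pos) : ℕ :=
  if (w.eventAt e).IsSend then 2 * h.exchangeOf e else 2 * h.exchangeOf e + 1

theorem key_div_two (h : Follows w b) (e : w.Pos) : h.key e / 2 = h.exchangeOf e := by
  unfold key
  split_ifs <;> omega

theorem isSend_of_key (h : Follows w b) {e : w.Pos} {n : ℕ} (he : h.key e = 2 * n) :
    (w.eventAt e).IsSend := by
  unfold key at he
  split_ifs at he with hs
  · exact hs
  · omega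

theorem isRecv_of_key (h : Follows w b) {e : w.Pos} {n : ℕ} (he : h.key e = 2 * n + 1) :
    (w.eventAt e).IsRecv := by
  unfold key at he
  split_ifs at he with hs
  · omega
  · cases hev : w.eventAt e <;> simp_all [Event.IsSend, Event.IsRecv]

theorem key_injective (h : Follows w b) : Function.Injective h.key := by
  intro e e' heq
  have hn : h.exchangeOf e = h.exchangeOf e' := by rw [← key_div_two, heq, key_div_two]
  have ho := h.origin_exchangeOf e
  have ho' := h.origin_exchangeOf e'
  rw [← hn] at ho'
  have hev : w.eventAt e = w.eventAt e' := by
    have hm := ho.mem (w.nth_pos e)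
    have hm' := ho'.mem (w.nth_pos e')
    rcases h.exchanges (h.exchangeOf e) with hb | ⟨p, q, m, -, hb⟩
    · simp [hb] at hm
    · rw [hb] at hm hm'
      rcases List.mem_pair.1 hm with h1 | h1 <;> rcases List.mem_pair.1 hm' with h2 | h2 <;>
        simp [key, h1, h2, hn, Event.IsSend] at heq ⊢
  have hact := congrArg Event.actor hev
  rcases lt_trichotomy (e : ℕ) e' with hlt | hlt | hlt
  · exact absurd (h.origin_strictMono (w.nth_pos e) (w.nth_pos e') hact ho ho' hlt) (lt_irrefl _)
  · exact Subtype.ext hlt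
  · exact absurd (h.origin_strictMono (w.nth_pos e') (w.nth_pos e) hact.symm ho' ho hlt)
      (lt_irrefl _)

theorem key_of_matched (h : Follows w b) {e e' : w.Pos} (hm : w.Matched e e') :
    ∃ n, h.key e = 2 * n ∧ h.key e' = 2 * n + 1 := by
  have heq := h.origin_eq_of_matched hm (h.origin_exchangeOf e) (h.origin_exchangeOf e')
  obtain ⟨P, Q, m, he, he', -, -⟩ := hm
  refine ⟨h.exchangeOf e, ?_, ?_⟩
  · simp [key, eventAt_eq he, Event.IsSend]
  · simp [key, eventAt_eq he', Event.IsSend, heq]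

theorem key_le_of_order (h : Follows w b) {e e' : w.Pos}
    (ho : (w.msc h.channelCompliant).order e e') : h.key e ≤ h.key e' := by
  induction ho with
  | refl => exact le_rfl
  | @tail x y _ hstep ih =>
    refine ih.trans ?_
    rcases hstep with hl | ⟨P, hx, hy, hxy⟩
    · obtain ⟨n, h1, h2⟩ := h.key_of_matched hl
      omega
    · rcases hxy.eq_or_lt with heq | hlt
      · exact le_of_eq (congrArg h.key (Subtype.ext heq))
      · have h1 := h.origin_strictMono (w.nth_pos x) (w.nth_pos y) (hx.trans hy.symm)
          (h.origin_exchangeOf x) (h.origin_exchangeOf y) hlt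
        rw [← key_div_two, ← key_div_two] at h1
        omega

/-- The part of the exchange `b n` that occurs in `w`. -/
noncomputable def piece (h : Follows w b) (n : ℕ) : List w.Pos :=
  slot h.key (2 * n) ++ slot h.key (2 * n + 1)

theorem exists_linearisation (h : Follows w b) :
    ∃ u : Word w.Pos, (w.msc h.channelCompliant).IsLinearisation u ∧ IsConcat h.piece u := by
  obtain ⟨u, hu, hex, hmono⟩ := exists_sorted h.key_injective
  refine ⟨u, ⟨hex, fun i j e e' hi hj ho => hmono i j e e' hi hj (h.key_le_of_order ho)⟩,
    fun n => ?_, fun k => ?_⟩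
  · change ∃ k, joined h.piece n = _
    obtain ⟨k, hk⟩ := hu.1 (2 * n)
    exact ⟨k, (joined_pair _ _).trans hk⟩
  · obtain ⟨n, hn⟩ := hu.2 k
    refine ⟨n, ?_⟩
    change _ <+: joined h.piece n
    have hp : joined h.piece n = joined (slot h.key) (2 * n) := joined_pair _ _
    rw [hp]
    exact hn.trans (joined_prefix _ (by omega))

theorem synchronisable (h : Follows w b) : w.Synchronisable 1 := by
  obtain ⟨u, hu, hp⟩ := h.exists_linearisation
  refine ⟨h.channelCompliant, u, hu, h.piece, hp, fun n => ?_, fun e e' hl => ?_⟩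
  · refine ⟨_, _, rfl, length_slot_le _ _, length_slot_le _ _, fun e he => ?_, fun e he => ?_⟩
    · exact h.isSend_of_key ((mem_slot_iff h.key_injective).1 he)
    · exact h.isRecv_of_key ((mem_slot_iff h.key_injective).1 he)
  · obtain ⟨n, h1, h2⟩ := h.key_of_matched hl
    exact ⟨n, List.mem_append_left _ ((mem_slot_iff h.key_injective).2 h1),
      List.mem_append_right _ ((mem_slot_iff h.key_injective).2 h2)⟩

/-- If every send is matched, then each exchange occurs in `w` completely or not at all. -/
theorem isExchangeSequence_piece (h : Follows w b) (hw : w.AllMatched) :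
    IsExchangeSequence fun n => (h.piece n).map w.eventAt := by
  intro n
  have hinj := h.key_injective
  by_cases hs : ∃ e, h.key e = 2 * n
  · obtain ⟨e, he⟩ := hs
    right
    have hsend := h.isSend_of_key he
    match hev : w.eventAt e with
    | .recv P Q m => simp [hev, Event.IsSend] at hsend
    | .send P Q m =>
      have hnth := (w.nth_pos e).trans (congrArg some hev)
      obtain ⟨j, hj⟩ := hw e P Q m hnth
      have hj' : w.nth j = some (Event.recv P Q m) := by
        obtain ⟨P', Q', m', h1, h2, -⟩ := hj
        cases hnth.symm.trans h1
        exact h2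
      obtain ⟨n', h1, h2⟩ := h.key_of_matched (e := e) (e' := ⟨j, by simp [hj']⟩) hj
      obtain rfl : n = n' := by omega
      refine ⟨P, Q, m, (h.exchanges.block_eq
        (Or.inl ((h.origin_exchangeOf e).mem hnth))).1, ?_⟩
      simp only [piece]
      rw [(slot_eq_singleton_iff hinj).2 h1, (slot_eq_singleton_iff hinj).2 h2]
      simp [hev, eventAt_eq (e := ⟨j, _⟩) hj']
  · left
    have h1 : slot h.key (2 * n) = [] :=
      List.eq_nil_iff_forall_not_mem.2 fun e he => hs ⟨e, (mem_slot_iff hinj).1 he⟩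
    have h2 : slot h.key (2 * n + 1) = [] := by
      refine List.eq_nil_iff_forall_not_mem.2 fun e he => ?_
      have hk := (mem_slot_iff hinj).1 he
      have hrecv := h.isRecv_of_key hk
      match hev : w.eventAt e with
      | .send P Q m => simp [hev, Event.IsRecv] at hrecv
      | .recv P Q m =>
        obtain ⟨i, hi⟩ := h.channelCompliant.exists_send
          ((w.nth_pos e).trans (congrArg some hev))
        have hi' : (w.nth i).isSome := by
          obtain ⟨_, _, _, h1, -⟩ := hi
          simp [h1]
        obtain ⟨n', h1, h2⟩ := h.key_of_matched (e := ⟨i, hi'⟩) (e' := e) hi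
        exact hs ⟨_, h1.trans (by omega)⟩
    simp [piece, h1, h2]

theorem existentiallyBounded (h : Follows w b) (hw : w.AllMatched) :
    w.ExistentiallyBounded 1 := by
  obtain ⟨u, hu, hp⟩ := h.exists_linearisation
  refine ⟨h.channelCompliant, u, hu, fun n P Q => ?_⟩
  obtain ⟨N, hN⟩ := hp.2 n
  have hpre : (u.map w.eventAt).take n <+: joined (fun n => (h.piece n).map w.eventAt) N := by
    have := hN.map w.eventAt
    rw [take_map]
    simpa [joined, List.map_flatten, Function.comp_def] using this
  have hlen := (h.isExchangeSequence_piece hw).length_sent_le hpre P Q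
  change ((sent P Q ((u.map w.eventAt).take n)).length : ℤ) -
    (received P Q ((u.map w.eventAt).take n)).length ≤ 1
  omega

end Follows

end Linearisation

/-! ### The execution language of a global type -/

section ExecutionLanguage

variable {Pr Msg : Type*}

open Word

theorem follows_of_indist {w : Word (Event Pr Msg)} {b : ℕ → List (Event Pr Msg)}
    (hb : IsExchangeSequence b) (h : ∀ k, ∃ n x, Indist (w.take k ++ x) (joined b n)) :
    Follows w b := by
  have hw : ∀ k, ∃ n x, HasProjections (fun p => proj p (joined b n)) (w.take k ++ x) := by
    intro k
    obtain ⟨n, x, hx⟩ := h k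
    exact ⟨n, x, (HasProjections.indist_iff hx).2
      ⟨hb.noSelfMessage n, hb.compliant n, fun _ => rfl⟩⟩
  refine ⟨hb, fun k P Q => ?_, fun k p => ?_⟩
  · obtain ⟨n, x, hx⟩ := hw k
    exact hx.compliant _ (List.prefix_append _ _) P Q
  · obtain ⟨n, x, hx⟩ := hw k
    exact ⟨n, hx.proj_eq p ▸ proj_prefix (List.prefix_append _ _) p⟩

/-- In a finite word indistinguishable from a sequence of complete exchanges, nothing stays
pending. -/
theorem allMatched_of_indist {u : List (Event Pr Msg)} {b : ℕ → List (Event Pr Msg)} {n : ℕ}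
    (hb : IsExchangeSequence b) (h : Indist u (joined b n)) : (fin u).AllMatched := by
  have hu : HasProjections (fun p => proj p (joined b n)) u :=
    (HasProjections.indist_iff h).2 ⟨hb.noSelfMessage n, hb.compliant n, fun _ => rfl⟩
  intro i P Q m hi
  have hall : (fin u).take u.length = u := by simp [take]
  have heq : sent P Q u = received P Q u := by
    rw [← sent_proj, hu.proj_eq, sent_proj, hb.sent_eq_received, ← received_proj, ← hu.proj_eq,
      received_proj]
  have hpre : sent P Q ((fin u).take i) ++ [m] <+: received P Q ((fin u).take u.length) := by
    rw [hall, ← heq, ← sent_take_succ hi]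
    exact sent_prefix (List.take_prefix _ _) P Q
  obtain ⟨j, -, hj, hrec⟩ := exists_reach _ _ _ _ _ hpre
  have hj := bind_recvMsg hj
  refine ⟨j, P, Q, m, hi, hj, ?_, (sent_take_succ hi).trans hrec.symm⟩
  by_contra! hle
  have hne : j ≠ i := by
    rintro rfl
    rw [hi] at hj
    cases hj
  have h1 := (hu.compliant _ (List.take_prefix (j + 1) u) P Q).length_le
  have h2 := (sent_prefix (take_prefix_take (fin u) (show j + 1 ≤ i by omega)) P Q).length_le
  have h3 := congrArg List.length hrec
  simp only [take, List.length_append, List.length_singleton] at h2 h3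
  unfold received at h1
  omega

namespace GlobalType

theorem Subterm.trans {H K G : GlobalType Pr Msg} (h : Subterm H K) (h' : Subterm K G) :
    Subterm H G := by
  induction h' with
  | refl => exact h
  | choice i _ ih => exact .choice i ih
  | mu _ ih => exact .mu ih

theorem Step.subterm {G s s' : GlobalType Pr Msg} {a : List (Event Pr Msg)} (h : Step G s a s')
    (hs : Subterm s G) : Subterm s' G := by
  cases h with
  | exchange p n q m H i => exact (Subterm.choice i (.refl _)).trans hs
  | enter t H => exact (Subterm.mu (.refl _)).trans hs
  | back t H h => exact h

theorem Step.trace {G s s' : GlobalType Pr Msg} (hG : G.WellFormed) {a : List (Event Pr Msg)}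
    (h : Step G s a s') (hs : Subterm s G) :
    a = [] ∨ ∃ p q m, p ≠ q ∧ a = [Event.send p q m, Event.recv p q m] := by
  cases h with
  | exchange p n q m H i => exact Or.inr ⟨p, q i, m i, hG.no_self_message p n q m H hs i, rfl⟩
  | enter | back => exact Or.inl rfl

theorem Run.exists_exchangeSequence {G s s' : GlobalType Pr Msg} (hG : G.WellFormed)
    {u : List (Event Pr Msg)} (h : Run G s u s') (hs : Subterm s G) :
    ∃ b n, IsExchangeSequence b ∧ u = joined b n := by
  induction h with
  | nil => exact ⟨fun _ => [], 0, fun _ => Or.inl rfl, rfl⟩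
  | @cons s a s' w s'' hstep _ ih =>
    obtain ⟨b, n, hb, rfl⟩ := ih (hstep.subterm hs)
    let b' : ℕ → List (Event Pr Msg)
      | 0 => a
      | k + 1 => b k
    refine ⟨b', n + 1, ?_, (joined_succ' b' n).symm⟩
    rintro (_ | k)
    · exact hstep.trace hG hs
    · exact hb k

theorem exists_isConcat_of_mem_language {G : GlobalType Pr Msg} (hG : G.WellFormed)
    {w : Word (Event Pr Msg)} (hw : w ∈ G.language) :
    (∃ b n, IsExchangeSequence b ∧ w = fin (joined b n)) ∨
      ∃ b, IsExchangeSequence b ∧ IsConcat b w := by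
  rcases hw with ⟨u, rfl, hrun⟩ | ⟨s, a, h0, hstep, hconcat⟩
  · obtain ⟨b, n, hb, rfl⟩ := hrun.exists_exchangeSequence hG (.refl G)
    exact Or.inl ⟨b, n, hb, rfl⟩
  · have hsub : ∀ n, Subterm (s n) G := by
      intro n
      induction n with
      | zero => exact h0 ▸ .refl _
      | succ n ih => exact (hstep n).subterm ih
    exact Or.inr ⟨a, fun n => (hstep n).trace hG (hsub n), hconcat⟩

/-- Every execution follows a sequence of exchanges, completely if it is finite. -/
theorem exists_follows {G : GlobalType Pr Msg} (hG : G.WellFormed) {w : Word (Event Pr Msg)}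
    (hw : w ∈ G.executionLanguage) :
    ∃ b, Follows w b ∧ (¬ w.IsInfinite → w.AllMatched) := by
  rcases hw with ⟨u, v, rfl, hv, huv⟩ | ⟨f, g, rfl, hg, hfg⟩
  · -- a finite concatenation of exchanges is reached by finitely many of them
    obtain ⟨b, n, hb, rfl⟩ : ∃ b n, IsExchangeSequence b ∧ v = joined b n := by
      rcases exists_isConcat_of_mem_language hG hv with ⟨b, n, hb, hvb⟩ | ⟨b, hb, hvb⟩
      · exact ⟨b, n, hb, Word.fin.inj hvb⟩
      · obtain ⟨n, hn⟩ := hvb.2 v.length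
        obtain ⟨k, hk⟩ := hvb.1 n
        refine ⟨b, n, hb, List.IsPrefix.eq_of_length_le (by simpa [take, joined] using hn) ?_⟩
        rw [joined, hk]
        exact (List.take_prefix _ _).length_le
    refine ⟨b, follows_of_indist hb fun k => ⟨n, u.drop k, ?_⟩, fun _ =>
      allMatched_of_indist hb huv⟩
    simpa [take] using huv
  · rcases exists_isConcat_of_mem_language hG hg with ⟨b, n, hb, hgb⟩ | ⟨b, hb, hgb⟩
    · cases hgb
    · refine ⟨b, follows_of_indist hb fun k => ?_, fun h => absurd trivial h⟩
      obtain ⟨l, x, hx⟩ := hfg k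
      obtain ⟨n, y, hy⟩ := hgb.2 l
      -- complete the last exchange of the prefix of `g`
      refine ⟨n, x ++ y, ?_⟩
      rw [joined, ← hy, ← List.append_assoc]
      exact hx.append_right y

end GlobalType

end ExecutionLanguage

theorem mainTheorem1 {Pr Msg : Type*} [Finite Pr] [Finite Msg] (G : GlobalType Pr Msg)
    (hG : G.WellFormed) :
    IsHalfDuplex G.executionLanguage ∧
    IsExistentiallyBounded 1 {w ∈ G.executionLanguage | w.IsInfinite → w.AllMatched} ∧
    IsSynchronisable 1 G.executionLanguage := by
  refine ⟨fun w hw => ?_, fun w hw => ?_, fun w hw => ?_⟩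
  · obtain ⟨b, hb, -⟩ := GlobalType.exists_follows hG hw
    exact hb.halfDuplex
  · obtain ⟨b, hb, hfin⟩ := GlobalType.exists_follows hG hw.1
    exact hb.existentiallyBounded ((em w.IsInfinite).elim hw.2 hfin)
  · obtain ⟨b, hb, -⟩ := GlobalType.exists_follows hG hw
    exact hb.synchronisable
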